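/- For a Boolean function $f:\{0,1\}^n\to\{0,1\}$ let $$\mathrm{D}_{\mathrm{ave}}(f)=\min_T\ \mathbb{E}_{x\in\{0,1\}^n}[\mathrm{cost}(T,x)],$$ where $x$ is uniformly distributed, $T$ ranges over all deterministic decision trees with $T(x)=f(x)$ for every $x$, and $\mathrm{cost}(T,x)$ is the number of queries $T$ makes on input $x$. The size of a CNF (respectively DNF) formula is its number of clauses (respectively terms). There is an absolute constant $C>0$ such that the following holds for all integers $n\ge 0$ and $s\ge 2$ with $C\log_2 s\le n$. If $f:\{0,1\}^n\to\{0,1\}$ is computed by a CNF or by a DNF of size at most $s$, then $$\mathrm{D}_{\mathrm{ave}}(f)\ \le\ n\left(1-\frac{1}{C\log_2 s}\right).$$ -/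

import Mathlib

open scoped BigOperators

namespace AvgQuery

/-- Boolean functions `{0,1}ⁿ → {0,1}`. -/
abbrev BoolFun (n : ℕ) : Type := (Fin n → Bool) → Bool

/-- Deterministic decision trees over `n` boolean variables. In `node i t₀ t₁` the variable `x i`
is queried; the computation continues in `t₀` if `x i = 0` and in `t₁` if `x i = 1`. -/
inductive DecisionTree (n : ℕ) : Type
  | leaf (b : Bool) : DecisionTree n
  | node (i : Fin n) (t₀ t₁ : DecisionTree n) : DecisionTree n

namespace DecisionTree

variable {n : ℕ}

/-- The value `T(x)`: the label of the leaf reached on input `x`. -/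
def eval : DecisionTree n → (Fin n → Bool) → Bool
  | leaf b, _ => b
  | node i t₀ t₁, x => if x i = true then t₁.eval x else t₀.eval x

/-- `cost(T, x)`: the length of the root-to-leaf path followed on input `x`. -/
def cost : DecisionTree n → (Fin n → Bool) → ℕ
  | leaf _, _ => 0
  | node i t₀ t₁, x => (if x i = true then t₁.cost x else t₀.cost x) + 1

/-- `T` computes `f` with zero error. -/
def Computes (T : DecisionTree n) (f : BoolFun n) : Prop :=
  ∀ x, T.eval x = f x

/-- The expected cost of `T` on a uniformly random input. -/
noncomputable def avgCost (T : DecisionTree n) : ℝ :=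
  𝔼 x : Fin n → Bool, (T.cost x : ℝ)

end DecisionTree

/-- The average-case deterministic query complexity: the minimum of the expected cost under the
uniform distribution over all decision trees computing `f`. The minimum is attained,
see `isLeast_Dave`. -/
noncomputable def Dave {n : ℕ} (f : BoolFun n) : ℝ :=
  sInf {r : ℝ | ∃ T : DecisionTree n, T.Computes f ∧ T.avgCost = r}

/-- Every boolean function is computed by some decision tree. -/
theorem exists_computes {n : ℕ} (f : BoolFun n) : ∃ T : DecisionTree n, T.Computes f := by
  have key : ∀ (l : List (Fin n)) (g : BoolFun n),
      (∀ x y, (∀ i ∈ l, x i = y i) → g x = g y) → ∃ T : DecisionTree n, T.Computes g := by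
    intro l
    induction l with
    | nil =>
      intro g hg
      exact ⟨.leaf (g fun _ => false), fun x => hg _ _ (by simp)⟩
    | cons i l ih =>
      intro g hg
      have h : ∀ b : Bool, ∃ T : DecisionTree n,
          T.Computes (fun x => g (Function.update x i b)) := by
        intro b
        refine ih _ fun x y hxy => hg _ _ fun j hj => ?_
        by_cases hji : j = i
        · subst hji; simp
        · have hjl : j ∈ l := by simpa [hji] using hj
          simp [Function.update_of_ne hji, hxy j hjl]
      obtain ⟨T₀, h₀⟩ := h false
      obtain ⟨T₁, h₁⟩ := h true
      refine ⟨.node i T₀ T₁, fun x => ?_⟩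
      have hx : Function.update x i (x i) = x := Function.update_eq_self i x
      cases hb : x i with
      | false => rw [hb] at hx; simp [DecisionTree.eval, hb, h₀ x, hx]
      | true => rw [hb] at hx; simp [DecisionTree.eval, hb, h₁ x, hx]
  exact key (List.finRange n) f fun x y h =>
    congrArg f (funext fun i => h i (List.mem_finRange i))

/-- The minimum in the definition of `Dave` is attained. -/
theorem isLeast_Dave {n : ℕ} (f : BoolFun n) :
    IsLeast {r : ℝ | ∃ T : DecisionTree n, T.Computes f ∧ T.avgCost = r} (Dave f) := by
  classical
  have hP : ∃ k : ℕ, ∃ T : DecisionTree n, T.Computes f ∧ ∑ x, T.cost x = k := by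
    obtain ⟨T, hT⟩ := exists_computes f
    exact ⟨_, T, hT, rfl⟩
  obtain ⟨T, hT, hk⟩ := Nat.find_spec hP
  have hL : IsLeast {r : ℝ | ∃ T : DecisionTree n, T.Computes f ∧ T.avgCost = r} T.avgCost := by
    refine ⟨⟨T, hT, rfl⟩, ?_⟩
    rintro r ⟨S, hS, rfl⟩
    have h1 : ∑ x, T.cost x ≤ ∑ x, S.cost x := by
      rw [hk]; exact Nat.find_min' hP ⟨S, hS, rfl⟩
    have h2 : (∑ x, (T.cost x : ℝ)) ≤ ∑ x, (S.cost x : ℝ) := by exact_mod_cast h1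
    unfold DecisionTree.avgCost
    rw [Fintype.expect_eq_sum_div_card, Fintype.expect_eq_sum_div_card]
    gcongr
  have : Dave f = T.avgCost := hL.csInf_eq
  rw [this]
  exact hL

/-- A literal: `(i, true)` is the variable `x i` and `(i, false)` is its negation. -/
abbrev Literal (n : ℕ) : Type := Fin n × Bool

/-- The value of a literal on input `x`. -/
def Literal.eval {n : ℕ} (l : Literal n) (x : Fin n → Bool) : Bool := x l.1 == l.2

/-- A CNF formula, as the list of its clauses; a clause is the list of its literals. -/
structure CNF (n : ℕ) : Type where
  clauses : List (List (Literal n))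

/-- A DNF formula, as the list of its terms; a term is the list of its literals. -/
structure DNF (n : ℕ) : Type where
  terms : List (List (Literal n))

/-- The number of clauses. -/
def CNF.size {n : ℕ} (F : CNF n) : ℕ := F.clauses.length

/-- The number of terms. -/
def DNF.size {n : ℕ} (F : DNF n) : ℕ := F.terms.length

/-- The AND of the clauses, each of which is the OR of its literals. -/
def CNF.eval {n : ℕ} (F : CNF n) (x : Fin n → Bool) : Bool :=
  F.clauses.all fun c => c.any fun l => Literal.eval l x

/-- The OR of the terms, each of which is the AND of its literals. -/
def DNF.eval {n : ℕ} (F : DNF n) (x : Fin n → Bool) : Bool :=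
  F.terms.any fun t => t.all fun l => Literal.eval l x

/-- The CNF `F` computes `f`. -/
def CNF.Computes {n : ℕ} (F : CNF n) (f : BoolFun n) : Prop := ∀ x, F.eval x = f x

/-- The DNF `F` computes `f`. -/
def DNF.Computes {n : ℕ} (F : DNF n) (f : BoolFun n) : Prop := ∀ x, F.eval x = f x

end AvgQuery

namespace AvgQuery

open Finset

variable {n : ℕ}

/-! ### Random subsets -/

/-! By De Morgan it is enough to treat an AND of at most `2 ^ m` clauses, up to negating the output.
Draw `S` by keeping each variable with probability `p = 1 / (4m)`, query everything outside `S`,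
then scan the clauses. The first phase costs `n (1 - p)` on average; the point is that the scan
costs only `O(1)`.

This is an encoding argument in the style of the switching lemma (`sum_charge_le`). If clause `c` is
charged for its unknown variables `A`, then `A ⊆ S`, an event of probability `p ^ #A`. Overwriting
`A` by a falsifying assignment gives an input whose first falsified clause is `c`, and this map is
at most `2 ^ #A` to one. Bounding the charge `#A` by `2 ^ #A` and summing over `A` gives `N (1 + 4p)
^ w`, where `w` is the width of `c` and `N` counts the inputs on which `c` is the first falsified
clause.

For `w ≤ m` the factor is at most 3, and the counts `N` sum to at most `2 ^ n`. For `w ≥ m`, `N ≤ 2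
^ (n - w)` makes each clause contribute at most `3 * 2 ^ n / 2 ^ m`. The scan thus costs at most 6
on average, and some `S` does at least as well as the mean. -/

/-- The probability of `S` when each element is included independently with probability `p`. -/
noncomputable def starWeight (p : ℝ) (S : Finset (Fin n)) : ℝ :=
  p ^ #S * (1 - p) ^ #(Sᶜ)

theorem starWeight_nonneg {p : ℝ} (h0 : 0 ≤ p) (h1 : p ≤ 1) (S : Finset (Fin n)) :
    0 ≤ starWeight p S :=
  mul_nonneg (pow_nonneg h0 _) (pow_nonneg (sub_nonneg.2 h1) _)

/-- Expand the product over `i` of `p + (1 - p)`, with the second summand deleted for `i ∈ A`: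
exactly the terms with `A ⊆ S` survive. -/
theorem sum_starWeight_superset (p : ℝ) (A : Finset (Fin n)) :
    ∑ S : Finset (Fin n), (if A ⊆ S then starWeight p S else 0) = p ^ #A := by
  have h := Finset.prod_add (fun _ : Fin n => p) (fun i => if i ∈ A then 0 else 1 - p) univ
  have hl : ∏ i : Fin n, (p + if i ∈ A then 0 else 1 - p) = p ^ #A := by
    have : ∀ i : Fin n, (p + if i ∈ A then 0 else 1 - p) = if i ∈ A then p else 1 := by
      intro i; split_ifs <;> ring
    simp only [this]
    rw [Finset.prod_ite_mem]
    simp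
  rw [hl, powerset_univ] at h
  rw [h]
  refine Finset.sum_congr rfl fun S _ => ?_
  split_ifs with hA
  · have hc : ∏ i ∈ univ \ S, (if i ∈ A then 0 else 1 - p) = (1 - p) ^ #(Sᶜ) := by
      rw [← Finset.compl_eq_univ_sdiff, ← prod_const]
      refine prod_congr rfl fun i hi => ?_
      rw [if_neg fun hiA => (mem_compl.1 hi) (hA hiA)]
    rw [hc, prod_const, starWeight]
  · obtain ⟨i, hiA, hiS⟩ := Finset.not_subset.1 hA
    rw [Finset.prod_eq_zero (i := i) (s := univ \ S) (by simpa using hiS) (by simp [hiA]), mul_zero]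

theorem sum_starWeight (p : ℝ) : ∑ S : Finset (Fin n), starWeight p S = 1 := by
  simpa using sum_starWeight_superset (n := n) p ∅

theorem sum_starWeight_mul_card (p : ℝ) :
    ∑ S : Finset (Fin n), starWeight p S * (#S : ℝ) = n * p := by
  have h : ∀ S : Finset (Fin n), starWeight p S * (#S : ℝ) =
      ∑ i : Fin n, if {i} ⊆ S then starWeight p S else 0 := by
    intro S
    simp [mul_comm]
  simp only [h]
  rw [Finset.sum_comm]
  simp only [sum_starWeight_superset]
  simp

theorem sum_starWeight_mul_card_compl (p : ℝ) :
    ∑ S : Finset (Fin n), starWeight p S * (#(Sᶜ) : ℝ) = n * (1 - p) := by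
  have h : ∀ S : Finset (Fin n), starWeight p S * (#(Sᶜ) : ℝ) =
      n * starWeight p S - starWeight p S * (#S : ℝ) := by
    intro S
    have : (#S : ℝ) + #(Sᶜ) = n := by
      exact_mod_cast (Finset.card_add_card_compl S).trans (Fintype.card_fin n)
    rw [← this]; ring
  simp only [h, sum_sub_distrib, ← mul_sum, sum_starWeight, sum_starWeight_mul_card]
  ring

/-! ### Scanning the clauses of a CNF -/

/-- The OR of the literals of `c`. -/
def clauseEval (c : List (Literal n)) (x : Fin n → Bool) : Bool := c.any fun l => Literal.eval l x

/-- The variables occurring in `c`. -/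
def clauseVars (c : List (Literal n)) : Finset (Fin n) := (c.map Prod.fst).toFinset

/-- The literals of `c` on variables in `K` already satisfy `c`. -/
def SatWithin (c : List (Literal n)) (K : Finset (Fin n)) (x : Fin n → Bool) : Prop :=
  ∃ l ∈ c, l.1 ∈ K ∧ Literal.eval l x = true

theorem mem_clauseVars {c : List (Literal n)} {l : Literal n} (h : l ∈ c) :
    l.1 ∈ clauseVars c := by
  rw [clauseVars, List.mem_toFinset]; exact List.mem_map_of_mem h

theorem literal_eval_congr {l : Literal n} {x y : Fin n → Bool} (h : x l.1 = y l.1) :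
    Literal.eval l x = Literal.eval l y := by
  simp [Literal.eval, h]

theorem clauseEval_congr {c : List (Literal n)} {x y : Fin n → Bool}
    (h : ∀ i ∈ clauseVars c, x i = y i) : clauseEval c x = clauseEval c y := by
  rw [Bool.eq_iff_iff]
  simp only [clauseEval, List.any_eq_true]
  refine exists_congr fun l => and_congr_right fun hl => ?_
  rw [literal_eval_congr (h _ (mem_clauseVars hl))]

theorem clauseEval_eq_false {c : List (Literal n)} {x : Fin n → Bool} :
    clauseEval c x = false ↔ ∀ l ∈ c, Literal.eval l x = false := by
  simp [clauseEval]

theorem SatWithin.clauseEval {c : List (Literal n)} {K : Finset (Fin n)} {x : Fin n → Bool}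
    (h : SatWithin c K x) : clauseEval c x = true := by
  obtain ⟨l, hl, -, he⟩ := h
  exact List.any_eq_true.2 ⟨l, hl, he⟩

theorem SatWithin.congr {c : List (Literal n)} {K : Finset (Fin n)} {x y : Fin n → Bool}
    (h : SatWithin c K x) (hxy : ∀ i ∈ K, x i = y i) : SatWithin c K y := by
  obtain ⟨l, hl, hK, he⟩ := h
  exact ⟨l, hl, hK, by rw [← he, literal_eval_congr (hxy _ hK)]⟩

/-- Two falsifying assignments of a clause agree on its variables. -/
theorem eq_of_clauseEval_eq_false {c : List (Literal n)} {x y : Fin n → Bool}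
    (hx : clauseEval c x = false) (hy : clauseEval c y = false) {i : Fin n}
    (hi : i ∈ clauseVars c) : x i = y i := by
  rw [clauseVars, List.mem_toFinset, List.mem_map] at hi
  obtain ⟨l, hl, rfl⟩ := hi
  have h1 := clauseEval_eq_false.1 hx l hl
  have h2 := clauseEval_eq_false.1 hy l hl
  simp only [Literal.eval, beq_eq_false_iff_ne, ne_eq] at h1 h2
  revert h1 h2
  cases x l.1 <;> cases y l.1 <;> cases l.2 <;> simp

open Classical in
/-- The variables known after processing the clause `c`. -/
noncomputable def knownAfter (c : List (Literal n)) (K : Finset (Fin n)) (x : Fin n → Bool) :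
    Finset (Fin n) :=
  if SatWithin c K x then K else K ∪ clauseVars c

open Classical in
/-- The number of queries made when processing the clause `c`. -/
noncomputable def charge (c : List (Literal n)) (K : Finset (Fin n)) (x : Fin n → Bool) : ℕ :=
  if SatWithin c K x then 0 else #(clauseVars c \ K)

/-- The number of queries made, when the variables in `K` are known, by the algorithm that goes
through the clauses in order, queries the unknown variables of every clause that is not yet
satisfied, and stops at the first falsified clause. -/
noncomputable def scanCost : List (List (Literal n)) → Finset (Fin n) → (Fin n → Bool) → ℕ
  | [], _, _ => 0
  | c :: cs, K, x =>
    charge c K x + if clauseEval c x = true then scanCost cs (knownAfter c K x) x else 0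

/-- Querying a set `V` of unknown variables before continuing. -/
theorem exists_tree_query (g : BoolFun n) (V : Finset (Fin n)) :
    ∀ (K : Finset (Fin n)) (_ : Disjoint V K) (k : (Fin n → Bool) → ℕ) (y : Fin n → Bool),
      (∀ y' : Fin n → Bool, (∀ i ∈ K, y' i = y i) →
        ∃ T : DecisionTree n, ∀ x, (∀ i ∈ K ∪ V, x i = y' i) → T.eval x = g x ∧ T.cost x = k x) →
      ∃ T : DecisionTree n, ∀ x, (∀ i ∈ K, x i = y i) → T.eval x = g x ∧ T.cost x = #V + k x := by
  induction V using Finset.induction_on with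
  | empty =>
    intro K _ k y h
    simpa using h y fun _ _ => rfl
  | insert i V hi ih =>
    intro K hK k y h
    rw [disjoint_insert_left] at hK
    have key : ∀ b : Bool, ∃ T : DecisionTree n, ∀ x,
        (∀ j ∈ insert i K, x j = Function.update y i b j) →
          T.eval x = g x ∧ T.cost x = #V + k x := by
      intro b
      refine ih (insert i K) (disjoint_insert_right.2 ⟨hi, hK.2⟩) k _ fun y' hy' => ?_
      obtain ⟨T, hT⟩ := h y' fun j hj => by
        have hji : j ≠ i := fun e => hK.1 (e ▸ hj)
        rw [hy' j (mem_insert_of_mem hj), Function.update_of_ne hji]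
      exact ⟨T, fun x hx => hT x fun j hj => hx j (by
        simp only [mem_union, mem_insert] at hj ⊢; tauto)⟩
    obtain ⟨T₀, h₀⟩ := key false
    obtain ⟨T₁, h₁⟩ := key true
    refine ⟨.node i T₀ T₁, fun x hx => ?_⟩
    have agree : ∀ b, x i = b → ∀ j ∈ insert i K, x j = Function.update y i b j := by
      intro b hb j hj
      by_cases hji : j = i
      · subst hji; simpa using hb
      · rw [Function.update_of_ne hji]
        exact hx j ((mem_insert.1 hj).resolve_left hji)
    cases hb : x i with
    | false =>
      obtain ⟨e1, e2⟩ := h₀ x (agree false hb)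
      simp only [DecisionTree.eval, DecisionTree.cost, hb, card_insert_of_notMem hi]
      exact ⟨by simpa using e1, by simp [e2]; ring⟩
    | true =>
      obtain ⟨e1, e2⟩ := h₁ x (agree true hb)
      simp only [DecisionTree.eval, DecisionTree.cost, hb, card_insert_of_notMem hi]
      exact ⟨by simpa using e1, by simp [e2]; ring⟩

/-- Fixing the known values `y` on `K` makes the induction possible: they decide whether the next
clause is already satisfied. The output map `h` lets the same scan serve CNFs and negated DNFs. -/
theorem exists_tree_scan (h : Bool → Bool) (cs : List (List (Literal n))) :
    ∀ (K : Finset (Fin n)) (y : Fin n → Bool), ∃ T : DecisionTree n, ∀ x, (∀ i ∈ K, x i = y i) →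
      T.eval x = h (cs.all fun c => clauseEval c x) ∧ T.cost x = scanCost cs K x := by
  induction cs with
  | nil =>
    intro K y
    exact ⟨.leaf (h true), fun x _ => by simp [DecisionTree.eval, DecisionTree.cost, scanCost]⟩
  | cons c cs ih =>
    intro K y
    by_cases hs : SatWithin c K y
    · obtain ⟨T, hT⟩ := ih K y
      refine ⟨T, fun x hx => ?_⟩
      have hsx : SatWithin c K x := hs.congr fun i hi => (hx i hi).symm
      obtain ⟨e1, e2⟩ := hT x hx
      simp [e1, e2, scanCost, charge, knownAfter, hsx, hsx.clauseEval]
    · obtain ⟨T, hT⟩ := exists_tree_query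
        (fun x => h ((c :: cs).all fun c => clauseEval c x)) (clauseVars c \ K) K
        sdiff_disjoint
        (fun x => if clauseEval c x = true then scanCost cs (K ∪ clauseVars c) x else 0) y (by
          intro y' _
          rw [union_sdiff_self_eq_union]
          have hc : ∀ x, (∀ i ∈ K ∪ clauseVars c, x i = y' i) → clauseEval c x = clauseEval c y' :=
            fun x hx => clauseEval_congr fun i hi => hx i (mem_union_right _ hi)
          cases hb : clauseEval c y' with
          | true =>
            obtain ⟨T, hT⟩ := ih (K ∪ clauseVars c) y'
            refine ⟨T, fun x hx => ?_⟩
            obtain ⟨e1, e2⟩ := hT x hx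
            simp [e1, e2, hc x hx, hb]
          | false =>
            -- A falsified clause settles the conjunction, so the scan stops here at no further
            -- cost.
            refine ⟨.leaf (h false), fun x hx => ?_⟩
            simp [DecisionTree.eval, DecisionTree.cost, hc x hx, hb])
      refine ⟨T, fun x hx => ?_⟩
      have hsx : ¬ SatWithin c K x := fun hsx => hs (hsx.congr hx)
      obtain ⟨e1, e2⟩ := hT x hx
      refine ⟨e1, ?_⟩
      simp [e2, scanCost, charge, knownAfter, hsx]

theorem exists_tree_of_known (h : Bool → Bool) (cs : List (List (Literal n)))
    (K : Finset (Fin n)) : ∃ T : DecisionTree n, ∀ x,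
      T.eval x = h (cs.all fun c => clauseEval c x) ∧ T.cost x = #K + scanCost cs K x := by
  obtain ⟨T, hT⟩ := exists_tree_query (fun x => h (cs.all fun c => clauseEval c x)) K ∅
    (disjoint_empty_right _) (scanCost cs K) (fun _ => false) (fun y' _ => by
      simpa using exists_tree_scan h cs K y')
  exact ⟨T, fun x => hT x (by simp)⟩

/-! ### The expected number of queries of the scan -/

/-- Overwriting the coordinates in `A` by those of `z` is at most `2 ^ #A` to one. -/
theorem card_filter_piecewise_le (A : Finset (Fin n)) (z : Fin n → Bool)
    (Q : (Fin n → Bool) → Prop) [DecidablePred Q] :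
    #{x | Q (A.piecewise z x)} ≤ 2 ^ #A * #{x | Q x} := by
  rw [← card_powerset, ← card_product]
  -- An input is recovered from its bits on `A` together with its overwritten version.
  refine card_le_card_of_injOn (fun x => (A.filter (x · = true), A.piecewise z x)) ?_ ?_
  · intro x hx
    simp only [coe_filter, mem_univ, true_and, Set.mem_ofPred_eq] at hx
    simp +contextual [hx, Set.subset_def]
  · intro x _ y _ hxy
    simp only [Prod.mk.injEq] at hxy
    funext i
    by_cases hi : i ∈ A
    · have := Finset.ext_iff.1 hxy.1 i
      simp only [mem_filter, hi, true_and] at this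
      exact Bool.eq_iff_iff.2 this
    · have := congrFun hxy.2 i
      simpa [hi] using this

/-- Falsifying inputs all agree on the variables of `c`, so replacing those bits by an arbitrary
pattern loses no information. -/
theorem card_clauseEval_false_le (c : List (Literal n)) :
    2 ^ #(clauseVars c) * #{x | clauseEval c x = false} ≤ 2 ^ n := by
  have : (2 : ℕ) ^ n = #(univ : Finset (Fin n → Bool)) := by simp
  rw [this, ← card_powerset, ← card_product]
  refine card_le_card_of_injOn
    (fun q => (clauseVars c).piecewise (fun i => decide (i ∈ q.1)) q.2) (by simp) ?_
  rintro ⟨B, x⟩ hx ⟨B', x'⟩ hx' e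
  simp only [coe_product, coe_powerset, coe_filter, mem_univ, true_and, Set.mem_prod,
    Set.mem_preimage, Set.mem_powerset_iff, coe_subset, Set.mem_ofPred_eq] at hx hx'
  simp only [Prod.mk.injEq]
  constructor
  · ext i
    by_cases hi : i ∈ clauseVars c
    · have := congrFun e i
      simpa [hi] using this
    · exact iff_of_false (fun h => hi (hx.1 h)) (fun h => hi (hx'.1 h))
  · funext i
    by_cases hi : i ∈ clauseVars c
    · exact eq_of_clauseEval_eq_false hx.2 hx'.2 hi
    · have := congrFun e i
      simpa [hi] using this

open Classical in
/-- If the processing of the clause `c` is charged, then overwriting the queried variables by a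
falsifying assignment of `c` preserves `P` and falsifies `c`. -/
theorem sum_charge_le {p : ℝ} (h0 : 0 ≤ p) (h1 : p ≤ 1) (c : List (Literal n))
    (z : Fin n → Bool) (hz : clauseEval c z = false) (P : (Fin n → Bool) → Prop)
    (K : Finset (Fin n) → (Fin n → Bool) → Finset (Fin n)) (hK : ∀ S x, Sᶜ ⊆ K S x)
    (hP : ∀ S x y, P x → (∀ i ∈ K S x, x i = y i) → P y) :
    ∑ x, ∑ S, starWeight p S * (if P x then (charge c (K S x) x : ℝ) else 0) ≤
      #{x | P x ∧ clauseEval c x = false} * (1 + 4 * p) ^ #(clauseVars c) := by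
  -- Only `A = clauseVars c \ K S x` matters; summing over all `A` removes the dependence of `A` on
  -- `x` and `S`, so the two sums can be evaluated separately.
  have hpt : ∀ x S, starWeight p S * (if P x then (charge c (K S x) x : ℝ) else 0) ≤
      ∑ A ∈ (clauseVars c).powerset, (2 : ℝ) ^ #A * ((if A ⊆ S then starWeight p S else 0) *
        (if P (A.piecewise z x) ∧ clauseEval c (A.piecewise z x) = false then 1 else 0)) := by
    intro x S
    have hw := starWeight_nonneg h0 h1 S
    have hnn : ∀ A ∈ (clauseVars c).powerset,
        0 ≤ (2 : ℝ) ^ #A * ((if A ⊆ S then starWeight p S else 0) *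
        (if P (A.piecewise z x) ∧ clauseEval c (A.piecewise z x) = false then 1 else 0)) := by
      intro A _
      split_ifs <;> simp [hw]
    by_cases hc : P x ∧ ¬ SatWithin c (K S x) x
    · obtain ⟨hPx, hs⟩ := hc
      refine le_trans ?_ (single_le_sum hnn (mem_powerset.2 sdiff_subset :
        clauseVars c \ K S x ∈ (clauseVars c).powerset))
      set A := clauseVars c \ K S x with hA
      have hAS : A ⊆ S := by
        intro i hi
        by_contra hiS
        exact (mem_sdiff.1 hi).2 (hK S x (mem_compl.2 hiS))
      have hPA : P (A.piecewise z x) := hP S x _ hPx fun i hi => by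
        rw [piecewise_eq_of_notMem]
        exact fun h => (mem_sdiff.1 h).2 hi
      have hcA : clauseEval c (A.piecewise z x) = false := by
        rw [clauseEval_eq_false]
        intro l hl
        by_cases hlK : l.1 ∈ K S x
        · have hlA : l.1 ∉ A := fun h => (mem_sdiff.1 h).2 hlK
          rw [literal_eval_congr (piecewise_eq_of_notMem A z x hlA)]
          by_contra he
          exact hs ⟨l, hl, hlK, by simpa using he⟩
        · have hlA : l.1 ∈ A := mem_sdiff.2 ⟨mem_clauseVars hl, hlK⟩
          rw [literal_eval_congr (piecewise_eq_of_mem A z x hlA)]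
          exact clauseEval_eq_false.1 hz l hl
      rw [if_pos hPx, if_pos hAS, if_pos ⟨hPA, hcA⟩, charge, if_neg hs, mul_one, mul_comm]
      gcongr
      exact_mod_cast (Nat.lt_two_pow_self).le
    · have : (if P x then (charge c (K S x) x : ℝ) else 0) = 0 := by
        rw [not_and_or, not_not] at hc
        rcases hc with hc | hc
        · simp [hc]
        · simp [charge, hc]
      rw [this, mul_zero]
      exact sum_nonneg hnn
  calc _ ≤ ∑ x, ∑ S, ∑ A ∈ (clauseVars c).powerset,
        (2 : ℝ) ^ #A * ((if A ⊆ S then starWeight p S else 0) *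
        (if P (A.piecewise z x) ∧ clauseEval c (A.piecewise z x) = false then 1 else 0)) :=
        sum_le_sum fun x _ => sum_le_sum fun S _ => hpt x S
    _ = ∑ A ∈ (clauseVars c).powerset, (2 * p) ^ #A *
          #{x | P (A.piecewise z x) ∧ clauseEval c (A.piecewise z x) = false} := by
        have : ∀ x : Fin n → Bool, ∑ S, ∑ A ∈ (clauseVars c).powerset,
            (2 : ℝ) ^ #A * ((if A ⊆ S then starWeight p S else 0) *
            (if P (A.piecewise z x) ∧ clauseEval c (A.piecewise z x) = false then 1 else 0)) =
            ∑ A ∈ (clauseVars c).powerset, (2 * p) ^ #A *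
            (if P (A.piecewise z x) ∧ clauseEval c (A.piecewise z x) = false then 1 else 0) := by
          intro x
          rw [sum_comm]
          refine sum_congr rfl fun A _ => ?_
          rw [← mul_sum, ← sum_mul, sum_starWeight_superset, mul_pow, mul_assoc]
        simp only [this]
        rw [sum_comm]
        refine sum_congr rfl fun A _ => ?_
        rw [← mul_sum, sum_boole]
    _ ≤ ∑ A ∈ (clauseVars c).powerset, (4 * p) ^ #A *
          #{x | P x ∧ clauseEval c x = false} := by
        refine sum_le_sum fun A _ => ?_
        have h := card_filter_piecewise_le A z (fun x => P x ∧ clauseEval c x = false)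
        have h' : (#{x | P (A.piecewise z x) ∧ clauseEval c (A.piecewise z x) = false} : ℝ) ≤
            2 ^ #A * #{x | P x ∧ clauseEval c x = false} := by exact_mod_cast h
        calc _ ≤ (2 * p) ^ #A * (2 ^ #A * #{x | P x ∧ clauseEval c x = false}) := by gcongr
          _ = _ := by rw [← mul_assoc, ← mul_pow]; ring_nf
    _ = _ := by
        rw [← sum_mul, mul_comm, add_comm]
        congr 1
        rw [← Finset.prod_const, Finset.prod_add]
        simp

/-- Weighing a clause by an exponential in its number of variables: short clauses get a constant
weight, long clauses are rarely falsified. -/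
theorem card_mul_pow_le {m : ℕ} {r : ℝ} (hr1 : 1 ≤ r) (hr2 : r ≤ 2) (hrm : r ^ m ≤ 3)
    (c : List (Literal n)) (N : ℕ) (hN : N ≤ #{x | clauseEval c x = false}) :
    (N : ℝ) * r ^ #(clauseVars c) ≤ 3 * N + 3 / 2 ^ m * 2 ^ n := by
  rcases le_total #(clauseVars c) m with h | h
  · have : r ^ #(clauseVars c) ≤ 3 := (pow_le_pow_right₀ hr1 h).trans hrm
    have h2 : (0 : ℝ) ≤ 3 / 2 ^ m * 2 ^ n := by positivity
    nlinarith [Nat.cast_nonneg (α := ℝ) N]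
  · have hc : (2 : ℝ) ^ #(clauseVars c) * N ≤ 2 ^ n := by
      exact_mod_cast (Nat.mul_le_mul_left _ hN).trans (card_clauseEval_false_le c)
    have hq : (r / 2) ^ #(clauseVars c) ≤ (r / 2) ^ m :=
      pow_le_pow_of_le_one (by linarith) (by linarith) h
    have hq' : (r / 2) ^ m ≤ 3 / 2 ^ m := by
      rw [div_pow]; gcongr
    have : (N : ℝ) * r ^ #(clauseVars c) =
        (r / 2) ^ #(clauseVars c) * (2 ^ #(clauseVars c) * N) := by
      rw [div_pow]; field_simp
    rw [this]
    have : (r / 2) ^ #(clauseVars c) * (2 ^ #(clauseVars c) * N) ≤ 3 / 2 ^ m * 2 ^ n :=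
      mul_le_mul (hq.trans hq') hc (by positivity) (by positivity)
    linarith [Nat.cast_nonneg (α := ℝ) N]

open Classical in
-- `P` stands for "the scan reaches this point". It must be determined by the known variables `K S
-- x`, so that overwriting unknown ones preserves it. Passing a clause keeps this invariant: the
-- clause was satisfied by a known literal, or all its variables became known.
theorem sum_scanCost_le {p : ℝ} {m : ℕ} (h0 : 0 ≤ p) (h1 : 4 * p ≤ 1)
    (hm : (1 + 4 * p) ^ m ≤ 3) (cs : List (List (Literal n)))
    (hcs : ∀ c ∈ cs, ∃ z, clauseEval c z = false) :
    ∀ (P : (Fin n → Bool) → Prop) (K : Finset (Fin n) → (Fin n → Bool) → Finset (Fin n)),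
      (∀ S x, Sᶜ ⊆ K S x) → (∀ S x y, P x → (∀ i ∈ K S x, x i = y i) → P y) →
      ∑ x, ∑ S, starWeight p S * (if P x then (scanCost cs (K S x) x : ℝ) else 0) ≤
        3 * #{x | P x ∧ ∃ c ∈ cs, clauseEval c x = false} + cs.length * (3 / 2 ^ m * 2 ^ n) := by
  induction cs with
  | nil => intro P K _ _; simp [scanCost]
  | cons c cs ih =>
    intro P K hK hP
    obtain ⟨z, hz⟩ := hcs c (by simp)
    have hhead := (sum_charge_le h0 (by linarith) c z hz P K hK hP).trans
      (card_mul_pow_le (by linarith) (by linarith) hm c _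
        (card_le_card (monotone_filter_right _ fun _ _ h => h.2)))
    have htail := ih (fun d hd => hcs d (List.mem_cons_of_mem _ hd))
      (fun x => P x ∧ clauseEval c x = true) (fun S x => knownAfter c (K S x) x)
      (fun S x => by
        unfold knownAfter
        split_ifs
        · exact hK S x
        · exact (hK S x).trans subset_union_left)
      (fun S x y hx hxy => by
        unfold knownAfter at hxy
        split_ifs at hxy with hs
        · exact ⟨hP S x y hx.1 hxy, (hs.congr hxy).clauseEval⟩
        · refine ⟨hP S x y hx.1 fun i hi => hxy i (mem_union_left _ hi), ?_⟩
          rw [← hx.2]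
          exact (clauseEval_congr fun i hi => hxy i (mem_union_right _ hi)).symm)
    -- Splitting by the first falsified clause keeps the counts disjoint, so the factor 3 is paid
    -- only once per input.
    have hcard : #{x | P x ∧ ∃ d ∈ c :: cs, clauseEval d x = false} =
        #{x | P x ∧ clauseEval c x = false} +
          #{x | (P x ∧ clauseEval c x = true) ∧ ∃ d ∈ cs, clauseEval d x = false} := by
      rw [← card_union_of_disjoint]
      · congr 1
        ext x
        simp only [List.mem_cons, exists_eq_or_imp, mem_filter, mem_univ, true_and, mem_union]
        cases clauseEval c x <;> simp
      · rw [disjoint_filter]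
        rintro x - ⟨-, h⟩ ⟨⟨-, h'⟩, -⟩
        simp [h] at h'
    have hsplit : ∑ x, ∑ S, starWeight p S *
          (if P x then (scanCost (c :: cs) (K S x) x : ℝ) else 0) =
        ∑ x, ∑ S, starWeight p S * (if P x then (charge c (K S x) x : ℝ) else 0) +
        ∑ x, ∑ S, starWeight p S * (if P x ∧ clauseEval c x = true then
          (scanCost cs (knownAfter c (K S x) x) x : ℝ) else 0) := by
      simp only [← sum_add_distrib, ← mul_add]
      refine sum_congr rfl fun x _ => sum_congr rfl fun S _ => ?_
      by_cases h : P x <;> by_cases h' : clauseEval c x = true <;> simp [scanCost, h, h']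
    have htail' : ∑ x, ∑ S, starWeight p S * (if P x ∧ clauseEval c x = true then
          (scanCost cs (knownAfter c (K S x) x) x : ℝ) else 0) ≤
        3 * #{x | (P x ∧ clauseEval c x = true) ∧ ∃ d ∈ cs, clauseEval d x = false} +
          cs.length * (3 / 2 ^ m * 2 ^ n) := by
      convert htail
    rw [hsplit, hcard]
    push_cast [List.length_cons]
    linarith

/-! ### The bound on the average-case query complexity -/

theorem Dave_le_avgCost {f : BoolFun n} {T : DecisionTree n} (hT : T.Computes f) :
    Dave f ≤ T.avgCost :=
  (isLeast_Dave f).2 ⟨T, hT, rfl⟩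

theorem Dave_le_of_falsifiable {p : ℝ} {m : ℕ} (h0 : 0 ≤ p) (h1 : 4 * p ≤ 1)
    (hm : (1 + 4 * p) ^ m ≤ 3) (cs : List (List (Literal n)))
    (hcs : ∀ c ∈ cs, ∃ z, clauseEval c z = false) (hlen : cs.length ≤ 2 ^ m)
    (h : Bool → Bool) (f : BoolFun n) (hf : ∀ x, f x = h (cs.all fun c => clauseEval c x)) :
    Dave f ≤ n * (1 - p) + 6 := by
  classical
  have hS : ∀ S : Finset (Fin n),
      Dave f ≤ #(Sᶜ) + (∑ x, (scanCost cs Sᶜ x : ℝ)) / 2 ^ n := by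
    intro S
    obtain ⟨T, hT⟩ := exists_tree_of_known h cs Sᶜ
    refine (Dave_le_avgCost (T := T) fun x => by rw [(hT x).1, hf x]).trans_eq ?_
    rw [DecisionTree.avgCost, Fintype.expect_eq_sum_div_card]
    simp only [(hT _).2, Nat.cast_add, sum_add_distrib]
    simp [add_div]
  have hsum := sum_scanCost_le h0 h1 hm cs hcs (fun _ => True) (fun S _ => Sᶜ)
    (fun _ _ => Subset.rfl) (fun _ _ _ _ _ => trivial)
  have hbound : ∑ x : Fin n → Bool, ∑ S, starWeight p S * (scanCost cs Sᶜ x : ℝ) ≤ 6 * 2 ^ n := by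
    have hl : (cs.length : ℝ) * (3 / 2 ^ m * 2 ^ n) ≤ 3 * 2 ^ n := by
      calc _ ≤ (2 : ℝ) ^ m * (3 / 2 ^ m * 2 ^ n) := by
            gcongr
            exact_mod_cast hlen
        _ = _ := by field_simp
    simp only [if_true] at hsum
    refine (hsum.trans (add_le_add (mul_le_mul_of_nonneg_left (c := 2 ^ n) ?_ (by norm_num))
      hl)).trans_eq (by ring)
    exact_mod_cast (card_le_univ _).trans_eq (by simp)
  calc Dave f = ∑ S : Finset (Fin n), starWeight p S * Dave f := by
        rw [← sum_mul, sum_starWeight, one_mul]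
    _ ≤ ∑ S : Finset (Fin n), starWeight p S *
          (#(Sᶜ) + (∑ x, (scanCost cs Sᶜ x : ℝ)) / 2 ^ n) := by
        refine sum_le_sum fun S _ => ?_
        exact mul_le_mul_of_nonneg_left (hS S) (starWeight_nonneg h0 (by linarith) S)
    _ = n * (1 - p) + (∑ x, ∑ S, starWeight p S * (scanCost cs Sᶜ x : ℝ)) / 2 ^ n := by
        simp only [mul_add, sum_add_distrib, sum_starWeight_mul_card_compl]
        rw [sum_comm (s := (univ : Finset (Fin n → Bool)))]
        simp only [← mul_sum, mul_div_assoc, sum_div]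
    _ ≤ n * (1 - p) + 6 := by
        gcongr
        rw [div_le_iff₀ (by positivity)]
        exact hbound

/-- Tautological clauses can be dropped. -/
theorem Dave_le_of_clauses {p : ℝ} {m : ℕ} (h0 : 0 ≤ p) (h1 : 4 * p ≤ 1)
    (hm : (1 + 4 * p) ^ m ≤ 3) (cs : List (List (Literal n))) (hlen : cs.length ≤ 2 ^ m)
    (h : Bool → Bool) (f : BoolFun n) (hf : ∀ x, f x = h (cs.all fun c => clauseEval c x)) :
    Dave f ≤ n * (1 - p) + 6 := by
  classical
  refine Dave_le_of_falsifiable h0 h1 hm (cs.filter fun c => ∃ z, clauseEval c z = false)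
    (fun c hc => by simpa using (List.mem_filter.1 hc).2)
    ((List.length_filter_le _ _).trans hlen) h f fun x => ?_
  rw [hf x]
  congr 1
  rw [Bool.eq_iff_iff]
  simp only [List.all_eq_true, List.mem_filter, decide_eq_true_eq]
  refine ⟨fun H c hc => H c hc.1, fun H c hc => ?_⟩
  by_contra hx
  exact hx (H c ⟨hc, x, by simpa using hx⟩)

/-- The literal-wise negation of the terms of a DNF. -/
def negClauses (ts : List (List (Literal n))) : List (List (Literal n)) :=
  ts.map fun t => t.map fun l => (l.1, !l.2)

theorem not_all_negClauses (ts : List (List (Literal n))) (x : Fin n → Bool) :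
    (!(negClauses ts).all fun c => clauseEval c x) =
      ts.any fun t => t.all fun l => Literal.eval l x := by
  rw [negClauses, List.all_map, List.not_all_eq_any_not]
  congr 1
  funext t
  simp only [Function.comp, clauseEval, List.any_map, List.not_any_eq_all_not]
  congr 1
  funext l
  simp only [Literal.eval]
  cases x l.1 <;> cases l.2 <;> rfl

theorem Dave_le_of_size {m : ℕ} (hm : 1 ≤ m) (f : BoolFun n)
    (hf : (∃ F : CNF n, F.size ≤ 2 ^ m ∧ F.Computes f) ∨
      (∃ F : DNF n, F.size ≤ 2 ^ m ∧ F.Computes f)) :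
    Dave f ≤ n * (1 - 1 / (4 * m)) + 6 := by
  have hm' : (1 : ℝ) ≤ m := by exact_mod_cast hm
  have e : 4 * (1 / (4 * m : ℝ)) = 1 / m := by field_simp
  have h0 : (0 : ℝ) ≤ 1 / (4 * m) := by positivity
  have h1 : 4 * (1 / (4 * m : ℝ)) ≤ 1 := by
    rw [e, div_le_one (by linarith)]; exact hm'
  -- With `p = 1 / (4m)` this is `(1 + 1/m) ^ m ≤ e`.
  have h2 : (1 + 4 * (1 / (4 * m : ℝ))) ^ m ≤ 3 := by
    rw [e]
    calc (1 + 1 / (m : ℝ)) ^ m ≤ Real.exp (1 / m) ^ m := by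
          gcongr
          rw [add_comm]; exact Real.add_one_le_exp _
      _ = Real.exp 1 := by
          rw [← Real.exp_nat_mul]; congr 1; field_simp
      _ ≤ 3 := by linarith [Real.exp_one_lt_d9]
  rcases hf with ⟨F, hF, hc⟩ | ⟨F, hF, hc⟩
  · exact Dave_le_of_clauses h0 h1 h2 F.clauses hF id f fun x => (hc x).symm
  · refine Dave_le_of_clauses h0 h1 h2 (negClauses F.terms)
      (by simpa [negClauses, DNF.size] using hF) not f fun x => ?_
    rw [not_all_negClauses]
    exact (hc x).symm

end AvgQuery

theorem mainTheorem6 :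
    ∃ C : ℝ, 0 < C ∧
      ∀ (n s : ℕ) (f : AvgQuery.BoolFun n), 2 ≤ s →
        ((∃ F : AvgQuery.CNF n, F.size ≤ s ∧ F.Computes f) ∨
          (∃ F : AvgQuery.DNF n, F.size ≤ s ∧ F.Computes f)) →
        C * Real.logb 2 (s : ℝ) ≤ (n : ℝ) →
        AvgQuery.Dave f ≤ (n : ℝ) * (1 - 1 / (C * Real.logb 2 (s : ℝ))) := by
  -- Rounding the logarithm up gives `m ≤ 2L`, hence a saving of at least `n / (8L) - 6`. As `n / L
  -- ≥ 96`, the first term is at least 12, which absorbs the 6 and leaves more than `n / (96L)`.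
  refine ⟨96, by norm_num, fun n s f hs hf hn => ?_⟩
  set L := Real.logb 2 (s : ℝ) with hL
  have hs' : (2 : ℝ) ≤ s := by exact_mod_cast hs
  have hL1 : 1 ≤ L := by
    rw [hL, Real.le_logb_iff_rpow_le (by norm_num) (by linarith)]; simpa using hs'
  set m := ⌈L⌉₊ with hm
  have hLm : L ≤ m := Nat.le_ceil L
  have hmL : (m : ℝ) ≤ 2 * L := by
    have := Nat.ceil_lt_add_one (by linarith : 0 ≤ L)
    linarith
  have hm1 : 1 ≤ m := by exact_mod_cast hL1.trans hLm
  have hsm : s ≤ 2 ^ m := by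
    have : (s : ℝ) ≤ (2 : ℝ) ^ (m : ℝ) :=
      (Real.logb_le_iff_le_rpow (by norm_num) (by linarith)).1 hLm
    rw [Real.rpow_natCast] at this
    exact_mod_cast this
  have hD := AvgQuery.Dave_le_of_size hm1 f (hf.imp
    (fun ⟨F, h, h'⟩ => ⟨F, h.trans hsm, h'⟩) (fun ⟨F, h, h'⟩ => ⟨F, h.trans hsm, h'⟩))
  have hLpos : 0 < L := by linarith
  have hmpos : (0 : ℝ) < m := by linarith
  have h1 : (n : ℝ) / (8 * L) ≤ n * (1 / (4 * m)) := by
    rw [mul_one_div]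
    exact div_le_div_of_nonneg_left (Nat.cast_nonneg n) (by linarith) (by linarith)
  have h2 : (96 : ℝ) ≤ n / L := by rwa [le_div_iff₀ hLpos]
  have h3 : (n : ℝ) / (8 * L) = n / L / 8 := by field_simp
  have h4 : (n : ℝ) * (1 / (96 * L)) = n / L / 96 := by field_simp
  rw [mul_sub, mul_one] at hD ⊢
  linarith
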